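/- Let $K$ be an oriented polygonal knot in $\mathbb{R}^3$ whose projection to the $xy$-plane is regular, i.e. finitely many points of the plane are images of more than one point of $K$ (the crossings), each of them is the image of exactly two points of $K$, and none of them is the image of a vertex; let $D$ be the resulting diagram. Breaking $K$ at the lower point of every crossing gives the strands of $D$; let $D$ have $n$ strands. Assume that $D$ is alternating (travelling along $K$, passages over and under crossings alternate) and reduced (no crossing can be removed by a twist move, i.e. there is no crossing $c$ such that one of the two arcs of $K$ from $c$ to $c$ contains no other crossing; in particular this holds if $D$ has no nugatory crossing). Let $M(T)$ be the matrix over $\mathbb{Z}[T,T^{-1}]$ with one row for each crossing and one column for each strand in which, in the row of a crossing, the overstrand has entry $1-T$, the understrand to the left of the overstrand has entry $-1$, the understrand to the right has entry $T$, and all other strands have entry $0$ (entries are added if these strands coincide). Let the Alexander polynomial $\Delta_K(T)\in\mathbb{Z}[T]$ be the generator with positive constant term of the ideal of $\mathbb{Z}[T,T^{-1}]$ generated by the $(n-1)\times(n-1)$ minors of $M(T)$, and suppose that the determinant $|\Delta_K(-1)|$ of $K$ is a prime number $p$. Then the knot code $\mathcal{C}_D=\{x\in\mathbb{F}_p^n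 : M(-1)x^\top=0\}$, whose elements are the Fox $(\mathbb{F}_p,-1)$-colorings of $D$, is an $[n,2,n-1]_p$ code: it has length $n$, dimension $2$ and minimum Hamming distance $n-1$. In particular it is MDS, i.e. dimension plus minimum distance equals $n+1$. -/

import Mathlib

open scoped LaurentPolynomial Polynomial

noncomputable section

/-! ### Oriented polygonal knots -/

/-- The point at time `t` of the closed polygon with cyclically ordered vertices `v`: at integer
times the polygon is at its vertices, and in between it moves along the edges at constant speed.
The map is periodic with period `m`. -/
def polygonPoint {m : ℕ} (v : ZMod m → EuclideanSpace ℝ (Fin 3)) (t : ℝ) :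
    EuclideanSpace ℝ (Fin 3) :=
  (1 - Int.fract t) • v (⌊t⌋ : ℤ) + Int.fract t • v ((⌊t⌋ : ℤ) + 1)

/-- An oriented polygonal knot in space: a closed polygon without self-intersections.
The orientation is the cyclic order of the vertices. -/
structure PolygonalKnot where
  /-- the number of vertices -/
  m : ℕ
  three_le : 3 ≤ m
  vertex : ZMod m → EuclideanSpace ℝ (Fin 3)
  /-- one tour of the polygon meets no point twice -/
  simple : Set.InjOn (polygonPoint vertex) (Set.Ico (0 : ℝ) m)

namespace PolygonalKnot

variable (K : PolygonalKnot)

/-- The parameters of one tour of the knot; they correspond bijectively to its points. -/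
def params : Set ℝ := Set.Ico (0 : ℝ) K.m

/-- The parametrization of the knot. -/
def point (t : ℝ) : EuclideanSpace ℝ (Fin 3) := polygonPoint K.vertex t

/-- The knot as a subset of space. -/
def carrier : Set (EuclideanSpace ℝ (Fin 3)) := K.point '' K.params

/-- The projection of the knot to the plane, `(x, y, z) ↦ (x, y)`. -/
def shadow (t : ℝ) : ℝ × ℝ := (K.point t 0, K.point t 1)

/-- The height above the plane. -/
def height (t : ℝ) : ℝ := K.point t 2

/-- The edge, as a vector, along which the knot travels at time `t`. -/
def edgeVector (t : ℝ) : EuclideanSpace ℝ (Fin 3) :=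
  K.vertex ((⌊t⌋ : ℤ) + 1) - K.vertex (⌊t⌋ : ℤ)

/-- The points of the plane over which there is more than one point of the knot. -/
def crossingPoints : Set (ℝ × ℝ) :=
  {Q | ∃ s ∈ K.params, ∃ t ∈ K.params, s ≠ t ∧ K.shadow s = Q ∧ K.shadow t = Q}

/-- The projection is regular: there are finitely many points of intersection, each of them is the
image of exactly two points of the knot, and none of them is the image of a vertex. -/
structure IsRegular : Prop where
  finite : K.crossingPoints.Finite
  double : ∀ Q ∈ K.crossingPoints, {t ∈ K.params | K.shadow t = Q}.ncard = 2
  vertex : ∀ k : ℕ, k < K.m → K.shadow k ∉ K.crossingPoints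

/-- `t` is a parameter at which the knot passes through a crossing. -/
def IsPassage (t : ℝ) : Prop := t ∈ K.params ∧ K.shadow t ∈ K.crossingPoints

/-- The knot passes over itself at time `t`. -/
def IsOver (t : ℝ) : Prop :=
  t ∈ K.params ∧ ∃ s ∈ K.params, K.shadow s = K.shadow t ∧ K.height s < K.height t

/-- The knot passes under itself at time `t`. -/
def IsUnder (t : ℝ) : Prop :=
  t ∈ K.params ∧ ∃ s ∈ K.params, K.shadow s = K.shadow t ∧ K.height t < K.height s

/-- The time needed to travel from parameter `a` along the orientation until parameter `b` is
reached (a full tour if `a = b`). -/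
def travel (a b : ℝ) : ℝ := if a < b then b - a else b - a + K.m

theorem heights_ne {s t : ℝ} (hs : s ∈ K.params) (ht : t ∈ K.params) (hne : s ≠ t)
    (h : K.shadow s = K.shadow t) : K.height s ≠ K.height t := by
  intro hz
  refine hne (K.simple hs ht ?_)
  simp only [shadow, Prod.mk.injEq] at h
  ext i
  fin_cases i
  · exact h.1
  · exact h.2
  · exact hz

end PolygonalKnot

/-! ### Knot diagrams: crossings and strands -/

/-- A diagram of an oriented polygonal knot: the knot together with the fact that its projection
is regular. The over/under information of the diagram is read off from the heights. -/
structure KnotDiagram extends PolygonalKnot where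
  regular : toPolygonalKnot.IsRegular

namespace KnotDiagram

variable (D : KnotDiagram)

/-- The crossings of the diagram. -/
def Crossing : Type := D.toPolygonalKnot.crossingPoints

instance : Fintype D.Crossing := D.regular.finite.fintype

instance : DecidableEq D.Crossing := Classical.decEq _

theorem exists_over_under (c : D.Crossing) :
    ∃ ou : ℝ × ℝ, ou.1 ∈ D.params ∧ ou.2 ∈ D.params ∧
      D.shadow ou.1 = c.1 ∧ D.shadow ou.2 = c.1 ∧ D.height ou.2 < D.height ou.1 := by
  obtain ⟨s, hs, t, ht, hne, h1, h2⟩ := c.2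
  rcases lt_or_gt_of_ne (D.heights_ne hs ht hne (h1.trans h2.symm)) with h | h
  · exact ⟨(t, s), ht, hs, h2, h1, h⟩
  · exact ⟨(s, t), hs, ht, h1, h2, h⟩

/-- The parameter of the upper one of the two points of the knot over a crossing. -/
def overTime (c : D.Crossing) : ℝ := (D.exists_over_under c).choose.1

/-- The parameter of the lower one of the two points of the knot over a crossing. -/
def underTime (c : D.Crossing) : ℝ := (D.exists_over_under c).choose.2

/-- Breaking the knot at the lower point of every crossing yields the strands. Every strand starts
at exactly one crossing (as soon as there are crossings at all), so the strands are labelled by the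
crossing at which they start, following the orientation. -/
abbrev Strand : Type := D.Crossing

/-- The point with parameter `t` lies on the strand `x`: it is passed after the start of the strand
and before the next passage under a crossing. -/
def OnStrand (x : D.Strand) (t : ℝ) : Prop :=
  t ∈ D.params ∧ ∀ c : D.Crossing,
    D.travel (D.underTime x) t < D.travel (D.underTime x) (D.underTime c)

/-- The strand `x` as a subset of the knot. -/
def strandArc (x : D.Strand) : Set (EuclideanSpace ℝ (Fin 3)) := D.point '' {t | D.OnStrand x t}

/-- If there are crossings, every point of the knot that does not pass under another one lies on
exactly one strand. -/
theorem existsUnique_strand [Nonempty D.Crossing] {t : ℝ} (ht : t ∈ D.params)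
    (hu : ¬ D.IsUnder t) : ∃! x : D.Strand, D.OnStrand x t := by
  have spec := fun c : D.Crossing => (D.exists_over_under c).choose_spec
  have mem : ∀ c : D.Crossing, D.underTime c ∈ D.params := fun c => (spec c).2.1
  have ne : ∀ c : D.Crossing, D.underTime c ≠ t := fun c h =>
    hu (h ▸ ⟨mem c, _, (spec c).1, (spec c).2.2.1.trans (spec c).2.2.2.1.symm, (spec c).2.2.2.2⟩)
  have inj : ∀ c c' : D.Crossing, D.underTime c = D.underTime c' → c = c' := fun c c' h =>
    Subtype.ext ((spec c).2.2.2.1.symm.trans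
      ((congrArg D.shadow h).trans (spec c').2.2.2.1))
  obtain ⟨x, -, hx⟩ := Finset.exists_min_image Finset.univ
    (fun c : D.Crossing => D.travel (D.underTime c) t) Finset.univ_nonempty
  refine ⟨x, ⟨ht, fun c => ?_⟩, fun y hy => ?_⟩
  · have h1 := hx c (Finset.mem_univ c)
    have hx0 := (mem x).1
    have hxm := (mem x).2
    have hc0 := (mem c).1
    have hcm := (mem c).2
    have ht0 := ht.1
    have htm := ht.2
    rcases lt_or_gt_of_ne (ne c) with h2 | h2 <;> rcases lt_or_gt_of_ne (ne x) with h3 | h3 <;>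
      simp only [PolygonalKnot.travel] at h1 ⊢ <;> split_ifs at h1 ⊢ <;> linarith
  · by_contra hxy
    have h1 := hx y (Finset.mem_univ y)
    have h2 := hy.2 x
    have hx0 := (mem x).1
    have hxm := (mem x).2
    have hy0 := (mem y).1
    have hym := (mem y).2
    have ht0 := ht.1
    have htm := ht.2
    have h5 : D.underTime y ≠ D.underTime x := fun h => hxy (inj _ _ h)
    rcases lt_or_gt_of_ne h5 with h5 | h5 <;> rcases lt_or_gt_of_ne (ne y) with h4 | h4 <;>
      rcases lt_or_gt_of_ne (ne x) with h3 | h3 <;>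
      simp only [PolygonalKnot.travel] at h1 h2 <;> split_ifs at h1 h2 <;> linarith

/-- `x` is the overstrand at the crossing `c`. -/
def IsOverstrand (x : D.Strand) (c : D.Crossing) : Prop := D.OnStrand x (D.overTime c)

/-- `x` is the understrand that leaves the crossing `c`. -/
def IsOutgoing (x : D.Strand) (c : D.Crossing) : Prop := x = c

/-- `x` is the understrand that arrives at the crossing `c`, i.e. the first passage under a
crossing after the start of `x` is the one at `c`. -/
def IsIncoming (x : D.Strand) (c : D.Crossing) : Prop :=
  ∀ c' : D.Crossing, D.travel (D.underTime x) (D.underTime c) ≤ D.travel (D.underTime x) (D.underTime c')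

/-- At `c` the lower branch of the knot crosses the upper branch from right to left, as seen when
following the upper branch along the orientation. -/
def RightToLeft (c : D.Crossing) : Prop :=
  0 < D.edgeVector (D.overTime c) 0 * D.edgeVector (D.underTime c) 1
    - D.edgeVector (D.overTime c) 1 * D.edgeVector (D.underTime c) 0

/-- `x` is an understrand at `c` at the left side of the overstrand. -/
def IsLeftUnderstrand (x : D.Strand) (c : D.Crossing) : Prop :=
  (D.RightToLeft c ∧ D.IsOutgoing x c) ∨ (¬ D.RightToLeft c ∧ D.IsIncoming x c)

/-- `x` is an understrand at `c` at the right side of the overstrand. -/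
def IsRightUnderstrand (x : D.Strand) (c : D.Crossing) : Prop :=
  (D.RightToLeft c ∧ D.IsIncoming x c) ∨ (¬ D.RightToLeft c ∧ D.IsOutgoing x c)

/-- The diagram is alternating: of any two consecutive passages through crossings, one is a passage
over and the other one is a passage under. -/
def IsAlternating : Prop :=
  ∀ s t : ℝ, D.IsPassage s → D.IsPassage t →
    (∀ r : ℝ, D.IsPassage r → D.travel s t ≤ D.travel s r) →
      (D.IsOver s ∧ D.IsUnder t) ∨ (D.IsUnder s ∧ D.IsOver t)

/-- The crossing `c` can be removed by a twist (first Reidemeister) move: one of the two arcs of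
the knot from `c` to `c` runs through no crossing on its way. -/
def IsKink (c : D.Crossing) : Prop :=
  (∀ t : ℝ, D.IsPassage t → D.travel (D.overTime c) (D.underTime c) ≤ D.travel (D.overTime c) t) ∨
  (∀ t : ℝ, D.IsPassage t → D.travel (D.underTime c) (D.overTime c) ≤ D.travel (D.underTime c) t)

/-- The diagram is reduced: no crossing can be removed by a twist move. -/
def IsReduced : Prop := ∀ c : D.Crossing, ¬ D.IsKink c

end KnotDiagram

/-! ### The Alexander matrix and the Alexander polynomial -/

/-- The `k`-th elementary (Fitting) ideal of a matrix with `n` columns: the ideal generated by the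
minors of size `n - k`. It is the unit ideal for `k ≥ n` (the empty minor is `1`), and zero if there
are fewer than `n - k` rows. -/
def elementaryIdeal {R ι κ : Type*} [CommRing R] [Fintype κ] (k : ℕ) (A : Matrix ι κ R) :
    Ideal R :=
  Ideal.span {d | ∃ (f : Fin (Fintype.card κ - k) ↪ ι) (g : Fin (Fintype.card κ - k) ↪ κ),
    d = (A.submatrix f g).det}

namespace KnotDiagram

variable (D : KnotDiagram)

open Classical in
/-- The Alexander (Fox coloring) matrix. Its rows belong to the crossings, its columns to the
strands; the entries are `1 - T` for the overstrand, `-1` for the understrand on the left and `T` for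
the understrand on the right. (If a strand plays several of these roles at a crossing, the
coefficients are added.) -/
def alexanderMatrix : Matrix D.Crossing D.Strand ℤ[T;T⁻¹] := fun c x =>
  (if D.IsOverstrand x c then 1 - LaurentPolynomial.T 1 else 0)
    + (if D.IsLeftUnderstrand x c then -1 else 0)
    + (if D.IsRightUnderstrand x c then LaurentPolynomial.T 1 else 0)

/-- `Δ` is the Alexander polynomial: the generator of the first elementary ideal of the Alexander
matrix that is a polynomial with positive constant term. -/
def IsAlexanderPolynomial (Δ : ℤ[X]) : Prop :=
  0 < Δ.coeff 0 ∧
    Ideal.span {Polynomial.toLaurent Δ} = elementaryIdeal 1 D.alexanderMatrix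

/-- The matrix `M(t)` over a ring `R`, for a unit `t` of `R`. -/
def foxMatrix {R : Type*} [CommRing R] (t : Rˣ) : Matrix D.Crossing D.Strand R :=
  D.alexanderMatrix.map (LaurentPolynomial.eval₂ (Int.castRingHom R) t)

/-- The knot code: the colorings of the strands by elements of `F` that are annihilated by
`M(t)`. -/
def knotCode {F : Type*} [Field F] (t : Fˣ) : Submodule F (D.Strand → F) :=
  LinearMap.ker (D.foxMatrix t).mulVecLin

end KnotDiagram

/-! ### Parameters of codes -/

/-- The minimum Hamming distance of a linear code; it is `∞` for the zero code. -/
def minDist {F ι : Type*} [Field F] [DecidableEq F] [Fintype ι] (C : Submodule F (ι → F)) : ℕ∞ :=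
  ⨅ x ∈ C, ⨅ _ : x ≠ 0, (hammingNorm x : ℕ∞)

/-- `C` is an `[n, k, d]` code over `F`. -/
def IsCode {F ι : Type*} [Field F] [DecidableEq F] [Fintype ι] (C : Submodule F (ι → F))
    (n k d : ℕ) : Prop :=
  Fintype.card ι = n ∧ Module.finrank F C = k ∧ minDist C = d

/-- The code attains the Singleton bound `k ≤ n - d + 1` (maximum distance separable). -/
def IsMDS {F ι : Type*} [Field F] [DecidableEq F] [Fintype ι] (C : Submodule F (ι → F)) : Prop :=
  (Module.finrank F C : ℕ∞) + minDist C = Fintype.card ι + 1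

end

/-!
In an alternating diagram every strand passes over exactly one crossing. Matching the crossings with
their overstrands turns `M(-1)` into the Laplacian `L` of a digraph on the strands, with an arrow
from the overstrand to either understrand at every crossing. Every vertex has two outgoing and two
incoming arrows, and there are no loops because the diagram is reduced.

It suffices that a nonconstant coloring `x` never takes a value twice: a coloring is then determined
by its values on two strands, and it vanishes at most once unless it is zero. Since the ideal of the
minors is `(p)` with `p` prime, the integer vectors `w` with coordinate sum zero and `w ⬝ᵥ x = 0`
are precisely those of the form `g ᵥ* L`. So if `x i = x j` for strands `i ≠ j`, then
`g ᵥ* L = e_i - e_j` for an integer potential `g`. Pairing this with `g` gives `g j < g i`, since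
`(g ᵥ* L) ⬝ᵥ g` is half the sum of the squared increments of `g`. The set `{v | g i ≤ g v}` thus
contains `i` but not `j`, and at most one arrow leaves it: an integer potential drops by at least
`1` along each of these arrows, while the total drop is `1`.

Choose minimal vertex sets left by at most one arrow, one inside this set and one inside its
complement. By submodularity of cuts, no such cut separates two points of a minimal set, so every
nonconstant coloring is injective on both of them. Neither set is a singleton, as two arrows leave
every vertex. But subtracting a constant from `x` on one side of a cut crossed by at most one arrow
each way, and setting `x` to zero on the other side, gives a coloring again, which is nonconstant on
one minimal set and constant on the other: a contradiction.
-/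

open scoped Matrix

section Minors

variable {V W R : Type*} [Fintype V] [CommRing R]

theorem map_elementaryIdeal {S : Type*} [CommRing S] (k : ℕ) (A : Matrix W V R) (φ : R →+* S) :
    (elementaryIdeal k A).map φ = elementaryIdeal k (A.map φ) := by
  rw [elementaryIdeal, elementaryIdeal, Ideal.map_span]
  congr 1
  ext d
  have hminor (f : Fin (Fintype.card V - k) ↪ W) (g : Fin (Fintype.card V - k) ↪ V) :
      φ (A.submatrix f g).det = ((A.map φ).submatrix f g).det := φ.map_det _
  constructor
  · rintro ⟨_, ⟨f, g, rfl⟩, rfl⟩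
    exact ⟨f, g, hminor f g⟩
  · rintro ⟨f, g, rfl⟩
    exact ⟨_, ⟨f, g, rfl⟩, hminor f g⟩

theorem elementaryIdeal_submatrix_equiv {W' : Type*} (k : ℕ) (A : Matrix W V R) (e : W' ≃ W) :
    elementaryIdeal k (A.submatrix e id) = elementaryIdeal k A := by
  rw [elementaryIdeal, elementaryIdeal]
  congr 1
  ext d
  constructor
  · rintro ⟨f, g, rfl⟩
    exact ⟨f.trans e.toEmbedding, g, rfl⟩
  · rintro ⟨f, g, rfl⟩
    exact ⟨f.trans e.symm.toEmbedding, g, by simp [Matrix.submatrix_submatrix, Function.comp_def]⟩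

theorem lt_card_of_elementaryIdeal_ne_top {k : ℕ} {A : Matrix W V R}
    (hA : elementaryIdeal k A ≠ ⊤) : k < Fintype.card V := by
  by_contra! hk
  have : IsEmpty (Fin (Fintype.card V - k)) := by
    rw [Nat.sub_eq_zero_of_le hk]
    infer_instance
  refine hA ((Ideal.eq_top_iff_one _).mpr (Ideal.subset_span ?_))
  exact ⟨Function.Embedding.ofIsEmpty, Function.Embedding.ofIsEmpty, Matrix.det_isEmpty.symm⟩

theorem ker_mulVecLin_submatrix_equiv {W' : Type*} (A : Matrix W V R) (e : W' ≃ W) :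
    LinearMap.ker (A.submatrix e id).mulVecLin = LinearMap.ker A.mulVecLin := by
  ext x
  simp only [LinearMap.mem_ker, Matrix.mulVecLin_apply]
  exact e.surjective.injective_comp_right.eq_iff (a := A *ᵥ x) (b := 0)

theorem mulVec_eq_zero_of_forall_ne {A : Matrix V V R} (hA : 1 ᵥ* A = 0) {y : V → R} {b : V}
    (hy : ∀ v ≠ b, (A *ᵥ y) v = 0) : A *ᵥ y = 0 := by
  have hsum : ∑ v, (A *ᵥ y) v = 0 := by
    rw [← one_dotProduct, Matrix.dotProduct_mulVec, hA, zero_dotProduct]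
  funext v
  rcases eq_or_ne v b with rfl | hv
  · rwa [Fintype.sum_eq_single _ hy] at hsum
  · exact hy v hv

theorem exists_equiv_option_extending {κ : Type*} [Fintype κ]
    (hκ : Fintype.card κ + 1 = Fintype.card V) (f : κ ↪ V) :
    ∃ e : Option κ ≃ V, ∀ i, e (some i) = f i := by
  classical
  obtain ⟨a, ha⟩ : ∃ a, a ∉ Set.range f := by
    by_contra! hsurj
    have := Fintype.card_le_of_surjective f hsurj
    omega
  refine ⟨Equiv.ofBijective (f.optionElim a ha) ?_, fun _ => rfl⟩
  rw [Fintype.bijective_iff_injective_and_card, Fintype.card_option]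
  exact ⟨(f.optionElim a ha).injective, hκ⟩

theorem exists_eq_mul_submatrix_of_one_vecMul_eq_zero {κ : Type*} [Fintype κ]
    (hκ : Fintype.card κ + 1 = Fintype.card V) {A : Matrix V W R} (hA : 1 ᵥ* A = 0)
    (f : κ ↪ V) : ∃ U : Matrix V κ R, A = U * A.submatrix f id := by
  classical
  obtain ⟨e, he⟩ := exists_equiv_option_extending hκ f
  refine ⟨Matrix.of fun v => (e.symm v).elim (-1) fun i => Pi.single i 1, ?_⟩
  ext v w
  obtain ⟨_ | i, rfl⟩ := e.surjective v
  · have hcol : A (e none) w + ∑ i, A (f i) w = 0 := by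
      simpa [Matrix.vecMul, dotProduct, ← e.sum_comp, he] using congrFun hA w
    simpa [Matrix.mul_apply] using eq_neg_of_add_eq_zero_left hcol
  · simp [Matrix.mul_apply, Pi.single_apply, ← he]

theorem det_submatrix_dvd_of_one_vecMul_eq_zero {κ : Type*} [Fintype κ] [DecidableEq κ]
    (hκ : Fintype.card κ + 1 = Fintype.card V) {A : Matrix V W R} (hA : 1 ᵥ* A = 0)
    (f f' : κ ↪ V) (g : κ → W) : (A.submatrix f g).det ∣ (A.submatrix f' g).det := by
  obtain ⟨U, hU⟩ := exists_eq_mul_submatrix_of_one_vecMul_eq_zero hκ hA f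
  have hfactor : A.submatrix f' g = U.submatrix f' id * A.submatrix f g := by
    conv_lhs => rw [hU]
    exact Matrix.submatrix_mul _ _ _ id _ Function.bijective_id
  rw [hfactor, Matrix.det_mul]
  exact dvd_mul_left _ _

theorem det_submatrix_dvd {κ : Type*} [Fintype κ] [DecidableEq κ]
    (hκ : Fintype.card κ + 1 = Fintype.card V) {A : Matrix V V R} (hrow : A *ᵥ 1 = 0)
    (hcol : 1 ᵥ* A = 0) (f f' g g' : κ ↪ V) :
    (A.submatrix f g).det ∣ (A.submatrix f' g').det := by
  have hrow' : 1 ᵥ* Aᵀ = 0 := by rw [Matrix.vecMul_transpose, hrow]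
  refine (det_submatrix_dvd_of_one_vecMul_eq_zero hκ hcol f f' g).trans ?_
  rw [← Matrix.det_transpose, ← Matrix.det_transpose (A.submatrix f' g')]
  exact det_submatrix_dvd_of_one_vecMul_eq_zero hκ hrow' g g' f'

variable [DecidableEq V]

theorem exists_adjugate_apply_self_eq_det_submatrix (A : Matrix V V R) (a : V) :
    ∃ f : Fin (Fintype.card V - 1) ↪ V, A.adjugate a a = (A.submatrix f f).det := by
  have hcard : Fintype.card V = Fintype.card V - 1 + 1 :=
    (Nat.sub_add_cancel (Fintype.card_pos_iff.mpr ⟨a⟩)).symm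
  let e := (Fintype.equivFinOfCardEq hcard).symm
  refine ⟨(Fin.succAboveEmb (e.symm a)).trans e.toEmbedding, ?_⟩
  have h := congrFun (congrFun (Matrix.adjugate_submatrix_equiv_self e A) (e.symm a)) (e.symm a)
  rw [Matrix.submatrix_apply, e.apply_symm_apply] at h
  rw [← h, Matrix.adjugate_fin_succ_eq_det_submatrix, Even.neg_one_pow ⟨_, rfl⟩, one_mul]
  rfl

theorem elementaryIdeal_one_eq_span_adjugate {A : Matrix V V R} (hrow : A *ᵥ 1 = 0)
    (hcol : 1 ᵥ* A = 0) (a : V) : elementaryIdeal 1 A = Ideal.span {A.adjugate a a} := by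
  obtain ⟨f, hf⟩ := exists_adjugate_apply_self_eq_det_submatrix A a
  have hcard : Fintype.card (Fin (Fintype.card V - 1)) + 1 = Fintype.card V := by
    rw [Fintype.card_fin, Nat.sub_add_cancel (Fintype.card_pos_iff.mpr ⟨a⟩)]
  refine le_antisymm (Ideal.span_le.mpr ?_) (Ideal.span_mono ?_)
  · rintro _ ⟨f', g', rfl⟩
    rw [SetLike.mem_coe, Ideal.mem_span_singleton, hf]
    exact det_submatrix_dvd hcard hrow hcol f f' f g'
  · exact Set.singleton_subset_iff.mpr ⟨f, f, hf⟩

theorem det_add_single (A : Matrix V V R) (i j : V) (r : R) :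
    (A + Matrix.single i j r).det = A.det + r * A.adjugate j i := by
  have hrow : A + Matrix.single i j r = A.updateRow i (A i + r • Pi.single j 1) := by
    ext v w
    rcases eq_or_ne v i with rfl | hv
    · simp [Matrix.single_apply, Pi.single_apply, eq_comm]
    · simp [hv, hv.symm]
  rw [hrow, Matrix.det_updateRow_add, Matrix.det_updateRow_smul, Matrix.updateRow_eq_self,
    Matrix.adjugate_apply]

theorem det_eq_zero_of_one_vecMul_eq_zero [IsDomain R] [Nonempty V] {A : Matrix V V R}
    (hA : 1 ᵥ* A = 0) : A.det = 0 :=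
  Matrix.exists_vecMul_eq_zero_iff.mp ⟨1, one_ne_zero, hA⟩

theorem adjugate_apply_self_eq_zero_iff [IsDomain R] {A : Matrix V V R} (hA : 1 ᵥ* A = 0) (a : V) :
    A.adjugate a a = 0 ↔ ∃ x ≠ 0, x a = 0 ∧ A *ᵥ x = 0 := by
  have : Nonempty V := ⟨a⟩
  have hdet : (A + Matrix.single a a 1).det = A.adjugate a a := by
    rw [det_add_single, det_eq_zero_of_one_vecMul_eq_zero hA, zero_add, one_mul]
  rw [← hdet, ← Matrix.exists_mulVec_eq_zero_iff]
  refine exists_congr fun x => and_congr_right fun _ => ⟨fun hx => ?_, fun ⟨hxa, hx⟩ => ?_⟩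
  · have hxa : x a = 0 := by
      have hsum : 1 ⬝ᵥ ((A + Matrix.single a a 1) *ᵥ x) = 0 := by rw [hx, dotProduct_zero]
      rw [Matrix.add_mulVec, dotProduct_add, Matrix.dotProduct_mulVec, hA] at hsum
      simpa [Matrix.single_mulVec, dotProduct, Function.update_apply] using hsum
    exact ⟨hxa, by simpa [Matrix.add_mulVec, Matrix.single_mulVec, hxa] using hx⟩
  · simp [Matrix.add_mulVec, Matrix.single_mulVec, hx, hxa]

end Minors

section RowLattice

theorem addSubgroup_eq_of_le_of_prime_index {G : Type*} [AddGroup G] {H K : AddSubgroup G}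
    (hle : H ≤ K) (hH : H.index.Prime) (hK : K ≠ ⊤) : K = H := by
  refine le_antisymm (AddSubgroup.relIndex_eq_one.mp ?_) hle
  have hmul := AddSubgroup.relIndex_mul_index hle
  rcases (Nat.prime_mul_iff.mp (hmul ▸ hH)) with ⟨-, hindex⟩ | ⟨-, hrel⟩
  · exact absurd (AddSubgroup.index_eq_one.mp hindex) hK
  · exact hrel

variable {V : Type*} [Fintype V] [DecidableEq V]

theorem index_range_vecMulLinear {N : Matrix V V ℤ} (hN : N.det ≠ 0) :
    N.vecMulLinear.range.toAddSubgroup.index = N.det.natAbs := by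
  have hinj : Function.Injective N.vecMulLinear := by
    refine (injective_iff_map_eq_zero _).mpr fun g hg => ?_
    by_contra hg0
    exact hN (Matrix.exists_vecMul_eq_zero_iff.mp ⟨g, hg0, hg⟩)
  let e := LinearEquiv.ofInjective N.vecMulLinear hinj
  have htranspose : N.vecMulLinear.range.subtype ∘ₗ
      AddMonoidHom.toIntLinearMap (e : (V → ℤ) →+ N.vecMulLinear.range) = Nᵀ.mulVecLin := by
    ext g v
    simp [e]
  have hdet := Submodule.natAbs_det_equiv N.vecMulLinear.range e
  rw [htranspose, ← Matrix.toLin'_apply', LinearMap.det_toLin', Matrix.det_transpose] at hdet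
  exact hdet.symm

variable {p : ℕ} [Fact p.Prime]

theorem exists_vecMul_eq_of_natAbs_det_eq_prime {N : Matrix V V ℤ} (hN : N.det.natAbs = p)
    {x : V → ZMod p} (hx : x ≠ 0) (hNx : N.map (Int.castRingHom (ZMod p)) *ᵥ x = 0)
    {w : V → ℤ} (hw : (Int.castRingHom (ZMod p) ∘ w) ⬝ᵥ x = 0) : ∃ g, g ᵥ* N = w := by
  have hp : p.Prime := Fact.out
  let φ : (V → ℤ) →+ ZMod p := AddMonoidHom.mk' (fun g => (Int.castRingHom (ZMod p) ∘ g) ⬝ᵥ x)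
    fun g h => by simp [dotProduct, add_mul, Finset.sum_add_distrib]
  have hle : N.vecMulLinear.range.toAddSubgroup ≤ φ.ker := by
    rintro _ ⟨g, rfl⟩
    have hmap : Int.castRingHom (ZMod p) ∘ (g ᵥ* N) =
        (Int.castRingHom (ZMod p) ∘ g) ᵥ* N.map (Int.castRingHom (ZMod p)) :=
      funext fun v => RingHom.map_vecMul _ N g v
    change (Int.castRingHom (ZMod p) ∘ (g ᵥ* N)) ⬝ᵥ x = 0
    rw [hmap, ← Matrix.dotProduct_mulVec, hNx, dotProduct_zero]
  have hindex : N.vecMulLinear.range.toAddSubgroup.index.Prime := by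
    rwa [index_range_vecMulLinear (by rintro h; simp [h, hp.ne_zero.symm] at hN), hN]
  have hker : φ.ker ≠ ⊤ := by
    obtain ⟨v, hv⟩ := Function.ne_iff.mp hx
    intro htop
    have hzero : φ (Pi.single v 1) = 0 := (htop ▸ AddSubgroup.mem_top _ : _ ∈ φ.ker)
    refine hv ?_
    simpa [φ, dotProduct, Pi.single_apply, Function.comp_def] using hzero
  have hmem : w ∈ φ.ker := hw
  rwa [addSubgroup_eq_of_le_of_prime_index hle hindex hker] at hmem

theorem exists_vecMul_eq_of_natAbs_adjugate_eq_prime {A : Matrix V V ℤ} (hrow : A *ᵥ 1 = 0)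
    (hcol : 1 ᵥ* A = 0) {a : V} (hA : (A.adjugate a a).natAbs = p) {x : V → ZMod p}
    (hx : ∃ b, x b ≠ x a) (hAx : A.map (Int.castRingHom (ZMod p)) *ᵥ x = 0)
    {w : V → ℤ} (hw : 1 ⬝ᵥ w = 0) (hwx : (Int.castRingHom (ZMod p) ∘ w) ⬝ᵥ x = 0) :
    ∃ g, g ᵥ* A = w := by
  have : Nonempty V := ⟨a⟩
  have hdet : (A + Matrix.single a a 1).det.natAbs = p := by
    rwa [det_add_single, det_eq_zero_of_one_vecMul_eq_zero hcol, zero_add, one_mul]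
  have hrow_p : A.map (Int.castRingHom (ZMod p)) *ᵥ 1 = 0 := by
    funext v
    simpa using ((Int.castRingHom (ZMod p)).map_mulVec A 1 v).symm.trans (by rw [hrow]; simp)
  have hshift : x - x a • 1 ≠ 0 := by
    obtain ⟨b, hb⟩ := hx
    exact Function.ne_iff.mpr ⟨b, by simpa [sub_eq_zero] using hb⟩
  have hNx : (A + Matrix.single a a 1).map (Int.castRingHom (ZMod p)) *ᵥ (x - x a • 1) = 0 := by
    rw [Matrix.map_add _ (map_add _), Matrix.add_mulVec, Matrix.mulVec_sub, Matrix.mulVec_smul,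
      hAx, hrow_p, Matrix.map_single, Matrix.single_mulVec]
    simp
  have hw_p : (Int.castRingHom (ZMod p) ∘ w) ⬝ᵥ 1 = 0 := by
    simpa [dotProduct] using congrArg (Int.cast : ℤ → ZMod p) hw
  obtain ⟨g, hg⟩ := exists_vecMul_eq_of_natAbs_det_eq_prime hdet hshift hNx (w := w)
    (by rw [dotProduct_sub, dotProduct_smul, hwx, hw_p, smul_zero, sub_zero])
  have hga : g a = 0 := by
    have hsum : (g ᵥ* (A + Matrix.single a a 1)) ⬝ᵥ 1 = 0 := by rw [hg, dotProduct_comm, hw]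
    rw [← Matrix.dotProduct_mulVec, Matrix.add_mulVec, hrow, zero_add] at hsum
    simpa [Matrix.single_mulVec, dotProduct, Function.update_apply] using hsum
  have hsingle : g ᵥ* Matrix.single a a 1 = 0 := by
    funext v
    simp [Matrix.vecMul, dotProduct, Matrix.single_apply, ite_and, hga]
  exact ⟨g, by rw [← hg, Matrix.vecMul_add, hsingle, add_zero]⟩

end RowLattice

section Digraph

variable {V ι R : Type*} [Fintype V] [DecidableEq V] [Fintype ι] [CommRing R]

/-- The Laplacian of the directed multigraph on `V` with an arrow `v ⟶ σ k v` for every vertex `v`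
and every label `k`. Since the `σ k` are permutations, every vertex is the tail and the head of
`Fintype.card ι` arrows; hence both the rows and the columns sum to zero. -/
def permLaplacian (σ : ι → Equiv.Perm V) (R : Type*) [CommRing R] : Matrix V V R :=
  ∑ k, (1 - (σ k).permMatrix R)

/-- The arrows `v ⟶ σ k v` that leave the vertex set `S`, encoded as pairs `(v, k)`. -/
def leavingArrows (σ : ι → Equiv.Perm V) (S : Finset V) : Finset (V × ι) :=
  {e | e.1 ∈ S ∧ σ e.2 e.1 ∉ S}

/-- The number of arrows that leave the vertex set `S`. -/
def cutSize (σ : ι → Equiv.Perm V) (S : Finset V) : ℕ :=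
  (leavingArrows σ S).card

/-- A nonempty vertex set is thin if at most one arrow leaves it. -/
def IsThin (σ : ι → Equiv.Perm V) (S : Finset V) : Prop :=
  S.Nonempty ∧ cutSize σ S ≤ 1

variable (σ : ι → Equiv.Perm V)

theorem permLaplacian_mulVec_apply (x : V → R) (v : V) :
    (permLaplacian σ R *ᵥ x) v = ∑ k, (x v - x (σ k v)) := by
  simp [permLaplacian, Matrix.sum_mulVec, Matrix.sub_mulVec, Matrix.permMatrix_mulVec,
    -Finset.sum_sub_distrib]

theorem vecMul_permLaplacian_apply (g : V → R) (v : V) :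
    (g ᵥ* permLaplacian σ R) v = ∑ k, (g v - g ((σ k).symm v)) := by
  simp [permLaplacian, Matrix.vecMul_sum, Matrix.vecMul_sub, Matrix.vecMul_permMatrix,
    -Finset.sum_sub_distrib]

@[simp]
theorem permLaplacian_mulVec_one : permLaplacian σ R *ᵥ 1 = 0 := by
  ext v
  simp [permLaplacian_mulVec_apply]

@[simp]
theorem one_vecMul_permLaplacian : 1 ᵥ* permLaplacian σ R = 0 := by
  ext v
  simp [vecMul_permLaplacian_apply]

omit [Fintype V] in
theorem map_permLaplacian {S : Type*} [CommRing S] (φ : R →+* S) :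
    (permLaplacian σ R).map φ = permLaplacian σ S := by
  ext v w
  simp only [permLaplacian, Matrix.map_apply, Matrix.sum_apply, map_sum]
  refine Finset.sum_congr rfl fun k _ => ?_
  simp [Matrix.one_apply, PEquiv.toMatrix_apply, apply_ite φ]

variable {σ}

theorem mem_leavingArrows {S : Finset V} {e : V × ι} :
    e ∈ leavingArrows σ S ↔ e.1 ∈ S ∧ σ e.2 e.1 ∉ S := by
  simp [leavingArrows]

variable (σ)

theorem indicator_dotProduct_permLaplacian_mulVec (S : Finset V) :
    (S : Set V).indicator 1 ⬝ᵥ (permLaplacian σ ℤ *ᵥ (S : Set V).indicator 1) = cutSize σ S := by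
  rw [cutSize, leavingArrows, Finset.card_filter, Nat.cast_sum, Fintype.sum_prod_type, dotProduct]
  refine Finset.sum_congr rfl fun v _ => ?_
  rw [permLaplacian_mulVec_apply, Finset.mul_sum]
  refine Finset.sum_congr rfl fun k _ => ?_
  by_cases hv : v ∈ S <;> by_cases hkv : σ k v ∈ S <;> simp [hv, hkv]

theorem cutSize_compl (S : Finset V) : cutSize σ Sᶜ = cutSize σ S := by
  rw [← Nat.cast_inj (R := ℤ), ← indicator_dotProduct_permLaplacian_mulVec,
    ← indicator_dotProduct_permLaplacian_mulVec, Finset.coe_compl, Set.indicator_compl,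
    Matrix.mulVec_sub, permLaplacian_mulVec_one, sub_dotProduct, zero_sub, dotProduct_neg,
    Matrix.dotProduct_mulVec, one_vecMul_permLaplacian]
  simp

theorem cutSize_inter_add_cutSize_union_le (S T : Finset V) :
    cutSize σ (S ∩ T) + cutSize σ (S ∪ T) ≤ cutSize σ S + cutSize σ T := by
  classical
  simp only [cutSize, ← Finset.card_union_add_card_inter (leavingArrows σ _)]
  refine Nat.add_le_add (Finset.card_le_card fun e => ?_) (Finset.card_le_card fun e => ?_) <;>
    simp only [Finset.mem_union, Finset.mem_inter, mem_leavingArrows] <;> tauto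

variable {σ}

theorem cutSize_singleton (hσ : ∀ k v, σ k v ≠ v) (v : V) : cutSize σ {v} = Fintype.card ι := by
  have hleaving : leavingArrows σ {v} = Finset.univ.map ⟨Prod.mk v, Prod.mk_right_injective v⟩ := by
    ext ⟨w, k⟩
    simp only [mem_leavingArrows, Finset.mem_singleton, Finset.mem_map, Finset.mem_univ, true_and,
      Function.Embedding.coeFn_mk, Prod.mk.injEq, exists_eq_right]
    exact ⟨fun h => h.1.symm, by rintro rfl; exact ⟨rfl, hσ k v⟩⟩
  rw [cutSize, hleaving, Finset.card_map, Finset.card_univ]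

theorem cutSize_superlevel_le (g : V → ℤ) (t : ℤ) :
    (cutSize σ {v | t ≤ g v} : ℤ) ≤ ∑ v with t ≤ g v, (g ᵥ* permLaplacian σ ℤ) v := by
  set S : Finset V := {v | t ≤ g v} with hS
  set s : V → ℤ := (S : Set V).indicator 1
  have hshift : (g ᵥ* permLaplacian σ ℤ) ⬝ᵥ s =
      (g - (t - 1) • 1) ⬝ᵥ (permLaplacian σ ℤ *ᵥ s) := by
    rw [Matrix.dotProduct_mulVec, Matrix.sub_vecMul, Matrix.smul_vecMul, one_vecMul_permLaplacian,
      smul_zero, sub_zero]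
  have hsum : ∑ v ∈ S, (g ᵥ* permLaplacian σ ℤ) v = (g ᵥ* permLaplacian σ ℤ) ⬝ᵥ s := by
    simp [dotProduct, s, Set.indicator_apply, Finset.sum_ite_mem]
  rw [hsum, hshift, ← indicator_dotProduct_permLaplacian_mulVec, dotProduct, dotProduct]
  refine Finset.sum_le_sum fun v _ => ?_
  rw [permLaplacian_mulVec_apply]
  by_cases hv : t ≤ g v
  · refine mul_le_mul_of_nonneg_right ?_ (Finset.sum_nonneg fun k _ => ?_)
    · have hone : 1 ≤ g v - (t - 1) := by omega
      simpa [hS, hv] using hone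
    · by_cases hkv : t ≤ g (σ k v) <;> simp [hS, hv, hkv]
  · refine mul_le_mul_of_nonpos_right ?_ (Finset.sum_nonpos fun k _ => ?_)
    · have hzero : g v - (t - 1) ≤ 0 := by omega
      simpa [hS, hv] using hzero
    · by_cases hkv : t ≤ g (σ k v) <;> simp [hS, hv, hkv]

theorem two_mul_vecMul_permLaplacian_dotProduct (g : V → R) :
    2 * ((g ᵥ* permLaplacian σ R) ⬝ᵥ g) = ∑ k, ∑ v, (g v - g (σ k v)) ^ 2 := by
  have hinv (k : ι) : ∑ v, g (σ k v) ^ 2 = ∑ v, g v ^ 2 := Equiv.sum_comp (σ k) fun v => g v ^ 2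
  have hsplit (k : ι) : ∑ v, (g v - g (σ k v)) ^ 2 = ∑ v, 2 * (g v * (g v - g (σ k v))) := by
    calc ∑ v, (g v - g (σ k v)) ^ 2
        = ∑ v, (2 * (g v * (g v - g (σ k v))) + (g (σ k v) ^ 2 - g v ^ 2)) :=
          Finset.sum_congr rfl fun v _ => by ring
      _ = ∑ v, 2 * (g v * (g v - g (σ k v))) := by
          rw [Finset.sum_add_distrib, Finset.sum_sub_distrib, hinv, sub_self, add_zero]
  rw [← Matrix.dotProduct_mulVec, dotProduct, Finset.sum_congr rfl fun k _ => hsplit k,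
    Finset.sum_comm]
  simp only [permLaplacian_mulVec_apply, Finset.mul_sum]

theorem vecMul_permLaplacian_dotProduct_pos {g : V → ℤ} (hg : g ᵥ* permLaplacian σ ℤ ≠ 0) :
    0 < (g ᵥ* permLaplacian σ ℤ) ⬝ᵥ g := by
  obtain ⟨v, hv⟩ := Function.ne_iff.mp hg
  rw [vecMul_permLaplacian_apply] at hv
  obtain ⟨k, -, hk⟩ := Finset.exists_ne_zero_of_sum_ne_zero hv
  have henergy : 0 < ∑ k, ∑ v, (g v - g (σ k v)) ^ 2 := by
    refine Finset.sum_pos' (fun _ _ => Finset.sum_nonneg fun _ _ => sq_nonneg _)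
      ⟨k, Finset.mem_univ k, Finset.sum_pos' (fun _ _ => sq_nonneg _)
        ⟨(σ k).symm v, Finset.mem_univ _, ?_⟩⟩
    rw [Equiv.apply_symm_apply, sub_sq_comm]
    exact sq_pos_of_ne_zero hk
  rw [← two_mul_vecMul_permLaplacian_dotProduct] at henergy
  exact pos_of_mul_pos_right henergy zero_le_two

theorem eq_univ_of_cutSize_eq_zero (hadj : ∀ a, (permLaplacian σ ℤ).adjugate a a ≠ 0)
    {S : Finset V} (hS : S.Nonempty) (hcut : cutSize σ S = 0) : S = Finset.univ := by
  by_contra hne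
  obtain ⟨a, ha⟩ : ∃ a, a ∉ S := by simpa [Finset.eq_univ_iff_forall] using hne
  refine hadj a ((adjugate_apply_self_eq_zero_iff (one_vecMul_permLaplacian σ) a).mpr
    ⟨(S : Set V).indicator 1, ?_, by simp [ha], ?_⟩)
  · obtain ⟨v, hv⟩ := hS
    exact Function.ne_iff.mpr ⟨v, by simp [hv]⟩
  · have hclosed (T : Finset V) (hT : cutSize σ T = 0) (v : V) (k : ι) (hv : v ∈ T) :
        σ k v ∈ T := by
      by_contra hkv
      have hmem : (v, k) ∈ leavingArrows σ T := mem_leavingArrows.mpr ⟨hv, hkv⟩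
      simp [Finset.card_eq_zero.mp hT] at hmem
    have hmem_iff (v : V) (k : ι) : σ k v ∈ S ↔ v ∈ S :=
      ⟨fun h => by_contra fun hv => by
        simpa [h] using hclosed Sᶜ ((cutSize_compl σ S).trans hcut) v k (by simpa using hv),
        hclosed S hcut v k⟩
    ext v
    simp [permLaplacian_mulVec_apply, Set.indicator_apply, hmem_iff]

theorem exists_minimal_isThin_subset {S : Finset V} (hS : IsThin σ S) :
    ∃ T ⊆ S, Minimal (IsThin σ) T :=
  exists_minimal_le_of_wellFoundedLT _ S hS

theorem IsThin.nontrivial {S : Finset V} (hS : IsThin σ S) (hσ : ∀ k v, σ k v ≠ v)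
    (hι : 2 ≤ Fintype.card ι) : S.Nontrivial := by
  refine hS.1.exists_eq_singleton_or_nontrivial.resolve_left ?_
  rintro ⟨v, rfl⟩
  have hcut := hS.2
  rw [cutSize_singleton hσ] at hcut
  omega

theorem subset_of_minimal_isThin_of_cutSize_le_one
    (hconn : ∀ S : Finset V, S.Nonempty → cutSize σ S = 0 → S = Finset.univ) {T : Finset V}
    (hT : Minimal (IsThin σ) T) (hTuniv : T ≠ Finset.univ) {S : Finset V}
    (hS : cutSize σ S ≤ 1) (hinter : (T ∩ S).Nonempty) : T ⊆ S := by
  have hunion {U : Finset V} (hU : cutSize σ U ≤ 1) (hTU : (T ∩ U).Nonempty) (hsub : ¬ T ⊆ U) :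
      T ∪ U = Finset.univ := by
    have htwo : ¬ cutSize σ (T ∩ U) ≤ 1 := fun hle =>
      hsub (Finset.inter_eq_left.mp (hT.eq_of_le ⟨hTU, hle⟩ Finset.inter_subset_left))
    have huncross := cutSize_inter_add_cutSize_union_le σ T U
    have hTcut := hT.prop.2
    exact hconn _ (hTU.mono (Finset.inter_subset_union)) (by omega)
  by_contra hsub
  obtain ⟨v, hvT, hvS⟩ := Finset.not_subset.mp hsub
  obtain ⟨u, hu⟩ := hinter
  have huT : u ∈ T := Finset.mem_of_mem_inter_left hu
  have huS : u ∈ S := Finset.mem_of_mem_inter_right hu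
  have hcover := hunion hS ⟨u, hu⟩ hsub
  have hcover_compl := hunion (U := Sᶜ) ((cutSize_compl σ S).trans_le hS) ⟨v, by simp [hvT, hvS]⟩
    fun h => by simpa [huS] using h huT
  refine hTuniv ?_
  rw [← Finset.inter_univ Finset.univ]
  nth_rw 1 [← hcover]
  rw [← hcover_compl, ← Finset.union_inter_distrib_left, Finset.inter_compl, Finset.union_empty]

theorem exists_forall_apply_eq_of_card_le_one {α β : Type*} [Nonempty β] {F : Finset α}
    (hF : F.card ≤ 1) (f : α → β) : ∃ c, ∀ a ∈ F, f a = c := by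
  rcases F.eq_empty_or_nonempty with rfl | ⟨a, ha⟩
  · exact ⟨Classical.arbitrary β, by simp⟩
  · exact ⟨f a, fun b hb => congrArg f (Finset.card_le_one.mp hF b hb a ha)⟩

/-- The constant is the value at the head of the arrow that leaves `S`, and the equation that
remains, at the tail of the arrow that enters `S`, follows from the others. -/
theorem exists_permLaplacian_mulVec_indicator_eq_zero {S : Finset V} (hS : cutSize σ S ≤ 1)
    {x : V → R} (hx : permLaplacian σ R *ᵥ x = 0) :
    ∃ c : R, permLaplacian σ R *ᵥ (S : Set V).indicator (fun v => x v - c) = 0 := by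
  rcases isEmpty_or_nonempty V with hV | hV
  · exact ⟨0, Subsingleton.elim _ _⟩
  obtain ⟨c, hc⟩ := exists_forall_apply_eq_of_card_le_one hS fun e => x (σ e.2 e.1)
  obtain ⟨b, hb⟩ := exists_forall_apply_eq_of_card_le_one ((cutSize_compl σ S).trans_le hS)
    (Prod.fst : V × ι → V)
  refine ⟨c, mulVec_eq_zero_of_forall_ne (one_vecMul_permLaplacian σ) (b := b) fun v hvb => ?_⟩
  rw [permLaplacian_mulVec_apply]
  by_cases hv : v ∈ S
  · have hdiff (k : ι) : (S : Set V).indicator (fun v => x v - c) v -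
        (S : Set V).indicator (fun v => x v - c) (σ k v) = x v - x (σ k v) := by
      by_cases hkv : σ k v ∈ S
      · simp [hv, hkv]
      · simp [hv, hkv, hc (v, k) (mem_leavingArrows.mpr ⟨hv, hkv⟩)]
    rw [Finset.sum_congr rfl fun k _ => hdiff k, ← permLaplacian_mulVec_apply, hx, Pi.zero_apply]
  · refine Finset.sum_eq_zero fun k _ => ?_
    have hkv : σ k v ∉ S := fun hkv =>
      hvb (hb (v, k) (mem_leavingArrows.mpr ⟨by simpa using hv, by simpa using hkv⟩))
    simp [hv, hkv]

section PrimeMinor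

variable {p : ℕ} [Fact p.Prime] (hadj : ∀ a, ((permLaplacian σ ℤ).adjugate a a).natAbs = p)
include hadj

theorem exists_cutSize_le_one_of_apply_eq {x : V → ZMod p}
    (hx : permLaplacian σ (ZMod p) *ᵥ x = 0) {i j : V} (hxij : x i = x j) (hij : i ≠ j)
    (hconst : ∃ a b, x a ≠ x b) : ∃ S : Finset V, i ∈ S ∧ j ∉ S ∧ cutSize σ S ≤ 1 := by
  have hi : ∃ b, x b ≠ x i := by
    obtain ⟨a, b, hab⟩ := hconst
    by_contra! hall
    exact hab ((hall a).trans (hall b).symm)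
  have hcast : Int.castRingHom (ZMod p) ∘ (Pi.single i 1 - Pi.single j 1 : V → ℤ) =
      Pi.single i 1 - Pi.single j 1 := by
    ext v
    simp [Pi.single_apply]
  obtain ⟨g, hg⟩ : ∃ g, g ᵥ* permLaplacian σ ℤ = Pi.single i 1 - Pi.single j 1 :=
    exists_vecMul_eq_of_natAbs_adjugate_eq_prime (permLaplacian_mulVec_one σ)
      (one_vecMul_permLaplacian σ) (hadj i) hi (by rwa [map_permLaplacian])
      (by simp [dotProduct_sub]) (by
        rw [hcast, sub_dotProduct, single_one_dotProduct, single_one_dotProduct, hxij, sub_self])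
  have hlt : g j < g i := by
    have hpos := vecMul_permLaplacian_dotProduct_pos (σ := σ) (g := g)
      (by rw [hg]; exact Function.ne_iff.mpr ⟨i, by simp [hij]⟩)
    rw [hg, sub_dotProduct, single_one_dotProduct, single_one_dotProduct] at hpos
    exact sub_pos.mp hpos
  refine ⟨({v | g i ≤ g v} : Finset V), by simp, by simpa using hlt, ?_⟩
  have hcut := cutSize_superlevel_le (σ := σ) g (g i)
  have hflow : ∑ v with g i ≤ g v, (g ᵥ* permLaplacian σ ℤ) v = 1 := by
    simp [hg, Finset.sum_sub_distrib, hlt.not_ge]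
  exact_mod_cast hcut.trans_eq hflow

theorem injOn_of_minimal_isThin {T : Finset V} (hT : Minimal (IsThin σ) T)
    (hTuniv : T ≠ Finset.univ) {x : V → ZMod p} (hx : permLaplacian σ (ZMod p) *ᵥ x = 0)
    (hconst : ∃ a b, x a ≠ x b) : Set.InjOn x T := by
  have hne (a : V) : (permLaplacian σ ℤ).adjugate a a ≠ 0 := fun h =>
    (Fact.out : p.Prime).ne_zero (by rw [← hadj a, h, Int.natAbs_zero])
  intro i hi j hj hxij
  by_contra hij
  obtain ⟨S, hiS, hjS, hS⟩ := exists_cutSize_le_one_of_apply_eq hadj hx hxij hij hconst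
  exact hjS (subset_of_minimal_isThin_of_cutSize_le_one
    (fun _ => eq_univ_of_cutSize_eq_zero hne) hT hTuniv hS ⟨i, Finset.mem_inter.mpr ⟨hi, hiS⟩⟩ hj)

theorem injective_of_permLaplacian_mulVec_eq_zero (hσ : ∀ k v, σ k v ≠ v)
    (hι : 2 ≤ Fintype.card ι) {x : V → ZMod p} (hx : permLaplacian σ (ZMod p) *ᵥ x = 0)
    (hconst : ∃ a b, x a ≠ x b) : Function.Injective x := by
  intro i j hxij
  by_contra hij
  obtain ⟨S, hiS, hjS, hS⟩ := exists_cutSize_le_one_of_apply_eq hadj hx hxij hij hconst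
  have hjS' : j ∈ Sᶜ := Finset.mem_compl.mpr hjS
  obtain ⟨T, hTS, hT⟩ := exists_minimal_isThin_subset ⟨⟨i, hiS⟩, hS⟩
  obtain ⟨T', hTS', hT'⟩ := exists_minimal_isThin_subset
    ⟨⟨j, hjS'⟩, (cutSize_compl σ S).trans_le hS⟩
  have hTuniv : T ≠ Finset.univ := fun h => hjS (hTS (h ▸ Finset.mem_univ j))
  have hTuniv' : T' ≠ Finset.univ := fun h =>
    Finset.mem_compl.mp (hTS' (h ▸ Finset.mem_univ i)) hiS
  obtain ⟨c, hc⟩ := exists_permLaplacian_mulVec_indicator_eq_zero hS hx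
  obtain ⟨u, hu, v, hv, huv⟩ := hT.prop.nontrivial hσ hι
  obtain ⟨u', hu', v', hv', huv'⟩ := hT'.prop.nontrivial hσ hι
  have hxuv : x u ≠ x v := fun h => huv (injOn_of_minimal_isThin hadj hT hTuniv hx hconst hu hv h)
  refine huv' (injOn_of_minimal_isThin hadj hT' hTuniv' hc ⟨u, v, ?_⟩ hu' hv' ?_)
  · simpa [hTS hu, hTS hv] using hxuv
  · simp [Finset.mem_compl.mp (hTS' hu'), Finset.mem_compl.mp (hTS' hv')]

theorem exists_permLaplacian_mulVec_eq_zero_nonconstant [Nonempty V] :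
    ∃ x : V → ZMod p, permLaplacian σ (ZMod p) *ᵥ x = 0 ∧ ∃ a b, x a ≠ x b := by
  obtain ⟨a⟩ := ‹Nonempty V›
  have hzero : (permLaplacian σ (ZMod p)).adjugate a a = 0 := by
    have hdvd : (p : ℤ) ∣ (permLaplacian σ ℤ).adjugate a a :=
      Int.natCast_dvd.mpr (dvd_of_eq (hadj a).symm)
    rw [← map_permLaplacian σ (Int.castRingHom (ZMod p)), ← RingHom.mapMatrix_apply,
      ← RingHom.map_adjugate, RingHom.mapMatrix_apply, Matrix.map_apply]
    exact (ZMod.intCast_zmod_eq_zero_iff_dvd _ p).mpr hdvd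
  obtain ⟨x, hx0, hxa, hx⟩ :=
    (adjugate_apply_self_eq_zero_iff (one_vecMul_permLaplacian σ) a).mp hzero
  obtain ⟨b, hb⟩ := Function.ne_iff.mp hx0
  exact ⟨x, hx, b, a, by rwa [hxa]⟩

end PrimeMinor

end Digraph

section Code

variable {F ι : Type*} [Field F]

theorem eq_zero_of_apply_eq_zero {C : Submodule F (ι → F)}
    (hinj : ∀ y ∈ C, (∃ a b, y a ≠ y b) → Function.Injective y) {y : ι → F} (hy : y ∈ C) {i j : ι}
    (hij : i ≠ j) (hi : y i = 0) (hj : y j = 0) : y = 0 := by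
  by_contra hy0
  obtain ⟨b, hb⟩ := Function.ne_iff.mp hy0
  exact hij (hinj y hy ⟨b, i, by rwa [hi]⟩ (hi.trans hj.symm))

variable {C : Submodule F (ι → F)} (hone : 1 ∈ C) (hnonconst : ∃ x ∈ C, ∃ a b, x a ≠ x b)
  (hinj : ∀ y ∈ C, (∃ a b, y a ≠ y b) → Function.Injective y)
include hone hnonconst hinj

theorem finrank_eq_two_of_forall_injective : Module.finrank F C = 2 := by
  obtain ⟨x, hx, i, j, hxij⟩ := hnonconst
  have hij : i ≠ j := fun h => hxij (congrArg x h)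
  have hdiff : x i - x j ≠ 0 := sub_ne_zero.mpr hxij
  let evalPair : C →ₗ[F] F × F := ((LinearMap.proj i).prod (LinearMap.proj j)).domRestrict C
  have hbij : Function.Bijective evalPair := by
    refine ⟨(injective_iff_map_eq_zero _).mpr fun y hy => ?_, fun ⟨r, s⟩ => ?_⟩
    · obtain ⟨hyi, hyj⟩ := Prod.mk.inj hy
      exact Subtype.ext (eq_zero_of_apply_eq_zero hinj y.2 hij hyi hyj)
    · let t := (r - s) / (x i - x j)
      have ht : t * (x i - x j) = r - s := div_mul_cancel₀ _ hdiff
      refine ⟨t • ⟨x, hx⟩ + (r - t * x i) • ⟨1, hone⟩, Prod.ext ?_ ?_⟩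
      · change t * x i + (r - t * x i) * 1 = r
        ring
      · change t * x j + (r - t * x i) * 1 = s
        linear_combination -ht
  rw [(LinearEquiv.ofBijective evalPair hbij).finrank_eq]
  simp

variable [DecidableEq F] [Fintype ι]

theorem minDist_eq_card_sub_one_of_forall_injective :
    minDist C = (Fintype.card ι - 1 : ℕ) := by
  classical
  have hnorm (y : ι → F) : ({a | y a = 0} : Finset ι).card + hammingNorm y = Fintype.card ι :=
    Finset.card_filter_add_card_filter_not _
  refine le_antisymm ?_ (le_iInf fun y => le_iInf fun hy => le_iInf fun hy0 => ?_)
  · obtain ⟨x, hx, i, j, hxij⟩ := hnonconst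
    have hmem : x - x i • 1 ∈ C := C.sub_mem hx (C.smul_mem _ hone)
    have hne : x - x i • 1 ≠ 0 :=
      Function.ne_iff.mpr ⟨j, by simpa [sub_eq_zero] using hxij.symm⟩
    refine (iInf₂_le_of_le _ hmem (iInf_le _ hne)).trans (Nat.cast_le.mpr ?_)
    have hzeros : 0 < ({a | (x - x i • 1) a = 0} : Finset ι).card :=
      Finset.card_pos.mpr ⟨i, by simp⟩
    have := hnorm (x - x i • 1)
    omega
  · have hzeros : ({a | y a = 0} : Finset ι).card ≤ 1 := by
      refine Finset.card_le_one.mpr fun a ha b hb => by_contra fun hab => hy0 ?_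
      exact eq_zero_of_apply_eq_zero hinj hy hab (by simpa using ha) (by simpa using hb)
    have := hnorm y
    exact Nat.cast_le.mpr (by omega)

theorem isCode_of_forall_injective : IsCode C (Fintype.card ι) 2 (Fintype.card ι - 1) :=
  ⟨rfl, finrank_eq_two_of_forall_injective hone hnonconst hinj,
    minDist_eq_card_sub_one_of_forall_injective hone hnonconst hinj⟩

omit hone hnonconst hinj

theorem IsCode.dim_le_length {n k d : ℕ} (hC : IsCode C n k d) : k ≤ n := by
  rw [← hC.1, ← hC.2.1, ← Module.finrank_fintype_fun_eq_card F]
  exact Submodule.finrank_le C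

theorem IsCode.isMDS {n k d : ℕ} (hC : IsCode C n k d) (hkd : k + d = n + 1) : IsMDS C := by
  rw [IsMDS, hC.1, hC.2.1, hC.2.2]
  exact_mod_cast hkd

end Code

theorem isCode_ker_permLaplacian {V ι : Type*} [Fintype V] [DecidableEq V] [Fintype ι]
    {σ : ι → Equiv.Perm V} (hσ : ∀ k v, σ k v ≠ v) (hι : 2 ≤ Fintype.card ι) {p : ℕ}
    [Fact p.Prime]
    (hideal : elementaryIdeal 1 (permLaplacian σ ℤ) = Ideal.span {(p : ℤ)}) :
    IsCode (LinearMap.ker (permLaplacian σ (ZMod p)).mulVecLin) (Fintype.card V) 2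
      (Fintype.card V - 1) := by
  have hadj (a : V) : ((permLaplacian σ ℤ).adjugate a a).natAbs = p := by
    rw [elementaryIdeal_one_eq_span_adjugate (permLaplacian_mulVec_one σ)
      (one_vecMul_permLaplacian σ) a, Ideal.span_singleton_eq_span_singleton,
      Int.associated_iff_natAbs] at hideal
    exact hideal
  have hcard : 1 < Fintype.card V := lt_card_of_elementaryIdeal_ne_top (by
    rw [hideal, Ne, Ideal.span_singleton_eq_top]
    exact (Nat.prime_iff_prime_int.mp Fact.out).not_isUnit)
  have : Nonempty V := Fintype.card_pos_iff.mp hcard.pos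
  refine isCode_of_forall_injective (permLaplacian_mulVec_one σ)
    (exists_permLaplacian_mulVec_eq_zero_nonconstant hadj) fun x hx hconst => ?_
  exact injective_of_permLaplacian_mulVec_eq_zero hadj hσ hι hx hconst

theorem exists_perm_forall_iff_eq {V : Type*} [Finite V] {r : V → V → Prop}
    (hex : ∀ x, ∃ c, r x c) (huniq : ∀ x y c, r x c → r y c → x = y) :
    ∃ σ : Equiv.Perm V, ∀ x c, r x c ↔ x = σ c := by
  choose next hnext using hex
  have hinj : Function.Injective next := fun x y h => huniq x y _ (hnext x) (h ▸ hnext y)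
  let e := Equiv.ofBijective next (Finite.injective_iff_bijective.mp hinj)
  refine ⟨e.symm, fun x c => ?_⟩
  have hc : r (e.symm c) c := by
    have h := hnext (e.symm c)
    rwa [show next (e.symm c) = c from e.apply_symm_apply c] at h
  exact ⟨fun h => huniq _ _ c h hc, by rintro rfl; exact hc⟩

namespace PolygonalKnot

variable {K : PolygonalKnot} {a b c d : ℝ}

theorem eq_of_travel_eq (hb : b ∈ K.params) (hc : c ∈ K.params)
    (h : K.travel a b = K.travel a c) : b = c := by
  obtain ⟨_, _⟩ := hb
  obtain ⟨_, _⟩ := hc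
  simp only [travel] at h
  split_ifs at h <;> linarith

theorem travel_lt_travel_of_lt (ha : a ∈ K.params) (hb : b ∈ K.params) (hc : c ∈ K.params)
    (hd : d ∈ K.params) (habc : K.travel a b < K.travel a c)
    (hbdc : K.travel b d < K.travel b c) : K.travel a d < K.travel a c := by
  obtain ⟨_, _⟩ := ha
  obtain ⟨_, _⟩ := hb
  obtain ⟨_, _⟩ := hc
  obtain ⟨_, _⟩ := hd
  simp only [travel] at habc hbdc ⊢
  split_ifs at habc hbdc ⊢ <;> linarith

theorem travel_le_travel_self (ha : a ∈ K.params) (hb : b ∈ K.params) :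
    K.travel a b ≤ K.travel a a := by
  obtain ⟨_, _⟩ := ha
  obtain ⟨_, _⟩ := hb
  simp only [travel]
  split_ifs <;> linarith

theorem eq_of_travel_le_travel_self (ha : a ∈ K.params) (hb : b ∈ K.params) (hc : c ∈ K.params)
    (hab : K.travel a c ≤ K.travel a b) (hba : K.travel b c ≤ K.travel b a) : a = b := by
  obtain ⟨_, _⟩ := ha
  obtain ⟨_, _⟩ := hb
  obtain ⟨_, _⟩ := hc
  by_contra hne
  rcases lt_or_gt_of_ne hne with hne | hne <;> simp only [travel] at hab hba <;>
    split_ifs at hab hba <;> linarith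

end PolygonalKnot

namespace KnotDiagram

section Passages

variable (D : KnotDiagram)

theorem overTime_mem (c : D.Crossing) : D.overTime c ∈ D.params :=
  (D.exists_over_under c).choose_spec.1

theorem underTime_mem (c : D.Crossing) : D.underTime c ∈ D.params :=
  (D.exists_over_under c).choose_spec.2.1

theorem shadow_overTime (c : D.Crossing) : D.shadow (D.overTime c) = c.1 :=
  (D.exists_over_under c).choose_spec.2.2.1

theorem shadow_underTime (c : D.Crossing) : D.shadow (D.underTime c) = c.1 :=
  (D.exists_over_under c).choose_spec.2.2.2.1

theorem height_underTime_lt_height_overTime (c : D.Crossing) :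
    D.height (D.underTime c) < D.height (D.overTime c) :=
  (D.exists_over_under c).choose_spec.2.2.2.2

theorem underTime_injective : Function.Injective D.underTime := fun c c' h =>
  Subtype.ext (by rw [← D.shadow_underTime c, h, D.shadow_underTime])

theorem underTime_ne_overTime (c c' : D.Crossing) : D.underTime c ≠ D.overTime c' := by
  intro h
  obtain rfl : c = c' := Subtype.ext (by rw [← D.shadow_underTime c, h, D.shadow_overTime])
  exact (D.height_underTime_lt_height_overTime c).ne (congrArg D.height h)

theorem eq_overTime_or_eq_underTime {c : D.Crossing} {t : ℝ} (ht : t ∈ D.params)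
    (htc : D.shadow t = c.1) : t = D.overTime c ∨ t = D.underTime c := by
  by_contra! hne
  have hfinite : {s ∈ D.params | D.shadow s = c.1}.Finite :=
    Set.finite_of_ncard_ne_zero (by rw [D.regular.double c.1 c.2]; exact two_ne_zero)
  have hsub : ({t, D.overTime c, D.underTime c} : Set ℝ) ⊆ {s ∈ D.params | D.shadow s = c.1} := by
    rintro s (rfl | rfl | rfl)
    exacts [⟨ht, htc⟩, ⟨D.overTime_mem c, D.shadow_overTime c⟩,
      ⟨D.underTime_mem c, D.shadow_underTime c⟩]
  have hcard := Set.ncard_le_ncard hsub hfinite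
  rw [D.regular.double c.1 c.2, Set.ncard_eq_three.mpr
    ⟨_, _, _, hne.1, hne.2, (D.underTime_ne_overTime c c).symm, rfl⟩] at hcard
  omega

theorem isPassage_overTime (c : D.Crossing) : D.IsPassage (D.overTime c) :=
  ⟨D.overTime_mem c, by rw [D.shadow_overTime]; exact c.2⟩

theorem isPassage_underTime (c : D.Crossing) : D.IsPassage (D.underTime c) :=
  ⟨D.underTime_mem c, by rw [D.shadow_underTime]; exact c.2⟩

theorem exists_eq_overTime_or_eq_underTime {t : ℝ} (ht : D.IsPassage t) :
    ∃ c, t = D.overTime c ∨ t = D.underTime c :=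
  ⟨⟨_, ht.2⟩, D.eq_overTime_or_eq_underTime ht.1 rfl⟩

theorem not_isOver_underTime (c : D.Crossing) : ¬ D.IsOver (D.underTime c) := by
  rintro ⟨-, s, hs, hshadow, hheight⟩
  rcases D.eq_overTime_or_eq_underTime hs (hshadow.trans (D.shadow_underTime c)) with rfl | rfl
  · exact lt_asymm hheight (D.height_underTime_lt_height_overTime c)
  · exact lt_irrefl _ hheight

theorem not_isUnder_overTime (c : D.Crossing) : ¬ D.IsUnder (D.overTime c) := by
  rintro ⟨-, s, hs, hshadow, hheight⟩
  rcases D.eq_overTime_or_eq_underTime hs (hshadow.trans (D.shadow_overTime c)) with rfl | rfl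
  · exact lt_irrefl _ hheight
  · exact lt_asymm hheight (D.height_underTime_lt_height_overTime c)

theorem exists_next_passage (x : D.Strand) :
    ∃ t, D.IsPassage t ∧ ∀ r, D.IsPassage r →
      D.travel (D.underTime x) t ≤ D.travel (D.underTime x) r := by
  obtain ⟨c, -, hc⟩ := Finset.exists_min_image Finset.univ
    (fun c : D.Crossing ⊕ D.Crossing =>
      D.travel (D.underTime x) (c.elim D.overTime D.underTime)) ⟨Sum.inl x, Finset.mem_univ _⟩
  refine ⟨c.elim D.overTime D.underTime, ?_, fun r hr => ?_⟩
  · rcases c with c | c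
    exacts [D.isPassage_overTime c, D.isPassage_underTime c]
  · obtain ⟨c', rfl | rfl⟩ := D.exists_eq_overTime_or_eq_underTime hr
    exacts [hc (Sum.inl c') (Finset.mem_univ _), hc (Sum.inr c') (Finset.mem_univ _)]

theorem exists_perm_isIncoming_iff :
    ∃ q : Equiv.Perm D.Crossing, ∀ x c, D.IsIncoming x c ↔ x = q c := by
  refine exists_perm_forall_iff_eq (fun x => ?_) fun x y c hx hy => ?_
  · obtain ⟨c, -, hc⟩ := Finset.exists_min_image Finset.univ
      (fun c => D.travel (D.underTime x) (D.underTime c)) ⟨x, Finset.mem_univ x⟩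
    exact ⟨c, fun c' => hc c' (Finset.mem_univ _)⟩
  · exact D.underTime_injective (PolygonalKnot.eq_of_travel_le_travel_self (D.underTime_mem x)
      (D.underTime_mem y) (D.underTime_mem c) (hx y) (hy x))

end Passages

section AlternatingReduced

variable {D : KnotDiagram}

theorem IsAlternating.exists_isOverstrand (halt : D.IsAlternating) (x : D.Strand) :
    ∃ c, D.IsOverstrand x c := by
  obtain ⟨t, ht, hmin⟩ := D.exists_next_passage x
  obtain ⟨hover, -⟩ | ⟨-, hover⟩ := halt _ t (D.isPassage_underTime x) ht hmin
  · exact absurd hover (D.not_isOver_underTime x)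
  obtain ⟨c, rfl | rfl⟩ := D.exists_eq_overTime_or_eq_underTime ht
  · refine ⟨c, D.overTime_mem c, fun c' =>
      (hmin _ (D.isPassage_underTime c')).lt_of_ne fun heq => ?_⟩
    exact D.underTime_ne_overTime c' c
      (PolygonalKnot.eq_of_travel_eq (D.overTime_mem c) (D.underTime_mem c') heq).symm
  · exact absurd hover (D.not_isOver_underTime c)

theorem IsAlternating.exists_perm_isOverstrand_iff (halt : D.IsAlternating) :
    ∃ o : Equiv.Perm D.Crossing, ∀ x c, D.IsOverstrand x c ↔ x = o c := by
  refine exists_perm_forall_iff_eq halt.exists_isOverstrand fun x y c hx hy => ?_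
  have : Nonempty D.Crossing := ⟨c⟩
  exact (D.existsUnique_strand (D.overTime_mem c) (D.not_isUnder_overTime c)).unique hx hy

variable {o : Equiv.Perm D.Crossing} (ho : ∀ x c, D.IsOverstrand x c ↔ x = o c)
include ho

theorem eq_of_isOverstrand {x : D.Strand} {c c' : D.Crossing} (hc : D.IsOverstrand x c)
    (hc' : D.IsOverstrand x c') : c = c' :=
  o.injective (((ho x c).mp hc).symm.trans ((ho x c').mp hc'))

theorem IsReduced.not_isOverstrand_self (hred : D.IsReduced) (c : D.Crossing) :
    ¬ D.IsOverstrand c c := by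
  intro hc
  refine hred c (Or.inr fun t ht => ?_)
  by_contra! hlt
  obtain ⟨c', rfl | rfl⟩ := D.exists_eq_overTime_or_eq_underTime ht
  · have hc' : D.IsOverstrand c c' := ⟨D.overTime_mem c', fun d => hlt.trans (hc.2 d)⟩
    obtain rfl : c' = c := eq_of_isOverstrand ho hc' hc
    exact lt_irrefl _ hlt
  · exact lt_asymm hlt (hc.2 c')

theorem IsReduced.not_isOverstrand_of_isIncoming (hred : D.IsReduced) {x : D.Strand}
    {c : D.Crossing} (hx : D.IsIncoming x c) : ¬ D.IsOverstrand x c := by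
  intro hc
  refine hred c (Or.inl fun t ht => ?_)
  by_contra! hlt
  have hbefore : D.travel (D.underTime x) t < D.travel (D.underTime x) (D.underTime c) :=
    PolygonalKnot.travel_lt_travel_of_lt (D.underTime_mem x) (D.overTime_mem c)
      (D.underTime_mem c) ht.1 (hc.2 c) hlt
  obtain ⟨c', rfl | rfl⟩ := D.exists_eq_overTime_or_eq_underTime ht
  · have hc' : D.IsOverstrand x c' := ⟨D.overTime_mem c', fun d => hbefore.trans_le (hx d)⟩
    obtain rfl : c' = c := eq_of_isOverstrand ho hc' hc
    exact hlt.not_ge (PolygonalKnot.travel_le_travel_self (D.overTime_mem c') (D.underTime_mem c'))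
  · exact hbefore.not_ge (hx c')

theorem IsReduced.perm_apply_ne {q : Equiv.Perm D.Crossing}
    (hq : ∀ x c, D.IsIncoming x c ↔ x = q c) (hred : D.IsReduced) (k : Fin 2) (x : D.Strand) :
    (![o.symm, o.symm.trans q] : Fin 2 → Equiv.Perm D.Crossing) k x ≠ x := by
  have hover : D.IsOverstrand x (o.symm x) := (ho x _).mpr (o.apply_symm_apply x).symm
  revert k
  refine Fin.forall_fin_two.mpr ⟨fun h => ?_, fun h => ?_⟩
  · exact hred.not_isOverstrand_self ho x (by rwa [show o.symm x = x from h] at hover)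
  · exact hred.not_isOverstrand_of_isIncoming ho ((hq x _).mpr h.symm) hover

end AlternatingReduced

section FoxMatrix

variable {D : KnotDiagram}

theorem IsAlexanderPolynomial.elementaryIdeal_foxMatrix_neg_one {Δ : ℤ[X]}
    (hΔ : D.IsAlexanderPolynomial Δ) :
    elementaryIdeal 1 (D.foxMatrix (-1 : ℤˣ)) = Ideal.span {Δ.eval (-1)} := by
  rw [foxMatrix, ← map_elementaryIdeal, ← hΔ.2, Ideal.map_span, Set.image_singleton,
    LaurentPolynomial.eval₂_toLaurent]
  rfl

variable {o q : Equiv.Perm D.Crossing} (ho : ∀ x c, D.IsOverstrand x c ↔ x = o c)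
  (hq : ∀ x c, D.IsIncoming x c ↔ x = q c)
include ho hq

theorem foxMatrix_neg_one_apply {R : Type*} [CommRing R] (c : D.Crossing) (x : D.Strand) :
    D.foxMatrix (-1 : Rˣ) c x =
      2 * (if x = o c then 1 else 0) - (if x = c then 1 else 0) - (if x = q c then 1 else 0) := by
  classical
  have hT : LaurentPolynomial.eval₂ (Int.castRingHom R) (-1 : Rˣ) (LaurentPolynomial.T 1) = -1 := by
    simp [LaurentPolynomial.eval₂_T]
  simp only [foxMatrix, Matrix.map_apply, alexanderMatrix, map_add, apply_ite
    (LaurentPolynomial.eval₂ (Int.castRingHom R) (-1 : Rˣ)), map_sub, map_one, map_neg, map_zero,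
    hT, ho, IsLeftUnderstrand, IsRightUnderstrand, IsOutgoing, hq]
  by_cases hdir : D.RightToLeft c <;> simp only [hdir, true_and, false_and, not_true,
    not_false_eq_true, or_false, false_or] <;> split_ifs <;> ring

theorem foxMatrix_neg_one_eq_submatrix_permLaplacian {R : Type*} [CommRing R] :
    D.foxMatrix (-1 : Rˣ) = (permLaplacian ![o.symm, o.symm.trans q] R).submatrix o id := by
  ext c x
  rw [foxMatrix_neg_one_apply ho hq]
  have ho' : o c = x ↔ x = o c := eq_comm
  have hc' : c = x ↔ x = c := eq_comm
  have hq' : q c = x ↔ x = q c := eq_comm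
  simp only [permLaplacian, Fin.sum_univ_two, Matrix.submatrix_apply, Matrix.add_apply,
    Matrix.sub_apply, Matrix.one_apply, Equiv.Perm.permMatrix, PEquiv.toMatrix_apply,
    Equiv.toPEquiv_apply, Option.mem_some_iff, Matrix.cons_val_zero, Matrix.cons_val_one,
    Equiv.trans_apply, Equiv.symm_apply_apply, id, ho', hc', hq']
  ring

end FoxMatrix

end KnotDiagram

theorem mainTheorem10 (D : KnotDiagram) (hred : D.IsReduced) (halt : D.IsAlternating)
    (n : ℕ) (hn : Fintype.card D.Strand = n)
    (Δ : Polynomial ℤ) (hΔ : D.IsAlexanderPolynomial Δ)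
    (p : ℕ) [Fact p.Prime] (hdet : |Δ.eval (-1)| = (p : ℤ)) :
    IsCode (D.knotCode (-1 : (ZMod p)ˣ)) n 2 (n - 1) ∧
      IsMDS (D.knotCode (-1 : (ZMod p)ˣ)) := by
  subst hn
  obtain ⟨o, ho⟩ := halt.exists_perm_isOverstrand_iff
  obtain ⟨q, hq⟩ := D.exists_perm_isIncoming_iff
  have hideal :
      elementaryIdeal 1 (permLaplacian ![o.symm, o.symm.trans q] ℤ) = Ideal.span {(p : ℤ)} := by
    rw [← elementaryIdeal_submatrix_equiv 1 _ o,
      ← KnotDiagram.foxMatrix_neg_one_eq_submatrix_permLaplacian ho hq,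
      hΔ.elementaryIdeal_foxMatrix_neg_one, ← hdet, Ideal.span_singleton_eq_span_singleton]
    exact Int.associated_iff_natAbs.mpr (Int.natAbs_abs _).symm
  have hcode := isCode_ker_permLaplacian (hred.perm_apply_ne ho hq) (by simp) hideal
  rw [← ker_mulVecLin_submatrix_equiv _ o,
    ← KnotDiagram.foxMatrix_neg_one_eq_submatrix_permLaplacian ho hq] at hcode
  exact ⟨hcode, hcode.isMDS (by have := hcode.dim_le_length; omega)⟩
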